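/- Let $K$ be an arbitrary field and let $Q$ be a finite connected non-empty quiver (loops and parallel arrows allowed); representations are finite-dimensional over $K$. For a representation $\psi$ of $Q$ let $\mathcal{E}(\psi)\subseteq\psi$ be the largest subrepresentation in which every arrow acts by a surjective map, and let $\psi\twoheadrightarrow\mathcal{M}(\psi)$ be the largest quotient in which every arrow acts by an injective map. In the image of the composition $\mathcal{E}(\psi)\hookrightarrow\psi\twoheadrightarrow\mathcal{M}(\psi)$ every arrow acts by an isomorphism; the common dimension of its spaces at the vertices is the global rank $\operatorname{rank}_Q(\psi)$. For a morphism of quivers $f\colon Q'\to Q$, the pullback of a representation $\psi=(W_x,\psi_a)$ of $Q$ is $f^*\psi=(W_{f(x)},\psi_{f(a)})$, and the pushforward of a representation $\phi=(V_y,\phi_b)$ of $Q'$ is $f_*\phi=\bigl(\bigoplus_{y\in f^{-1}(x)}V_y,\ \sum_{b\in f^{-1}(a)}\phi_b\bigr)$. A rank function on $Q$ is a function of the form $\psi\mapsto\operatorname{rank}_{Q_n}(F_{n-1}\cdots F_1\psi)$, where $Q=Q_1,Q_2,\dots,Q_n$ ($n\ge 1$) are finite connected non-empty quivers and each $F_i$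 is either the pushforward along a morphism $Q_i\to Q_{i+1}$ or the pullback along a morphism $Q_{i+1}\to Q_i$. Let $\alpha,\beta$ be dimension vectors for $Q$, and let $\phi=(\phi_a\colon K^{\alpha(ta)}\to K^{\alpha(ha)})_a$ be a point of the representation space $\operatorname{rep}(Q,\alpha)$. The quiver Grassmannian $\operatorname{Gr}(\phi,\beta)$ is the fiber over $\phi$ of the bundle $$\{(W,\phi')\in \textstyle\prod_x\operatorname{Gr}(\beta(x),K^{\alpha(x)})\times\operatorname{rep}(Q,\alpha)\;:\;\phi'_a(W_{ta})\subseteq W_{ha}\text{ for all arrows }a\}\longrightarrow\operatorname{rep}(Q,\alpha);$$ thus its points are the subrepresentations $W$ of $\phi$ of dimension vector $\beta$. It carries the Zariski topology as a subset of $\prod_x\operatorname{Gr}(\beta(x),K^{\alpha(x)})$ (the set of $K$-points, embedded in a product of projective spaces by the Plücker coordinates). A rank locus in $\operatorname{Gr}(\phi,\beta)$ is the set of all points $W$ that satisfy some finite list of linear inequalities (weak or strict, with real coefficients and constant terms) in the numbers $r_i(\phi|_W)$ and $r_i(\phi/W)$, where $r_1,\dots,r_m$ are rank functions on $Q$, $\phi|_W$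 is the representation of $Q$ given by $W$, and $\phi/W$ is the quotient representation. Then every rank locus in $\operatorname{Gr}(\phi,\beta)$ is a constructible subset of $\operatorname{Gr}(\phi,\beta)$, that is, it can be obtained from finitely many subsets, each of which is open or closed in $\operatorname{Gr}(\phi,\beta)$, via unions and intersections. -/

import Mathlib

universe u

namespace RankLoci

/-! ### Quivers and their representations -/

/-- A finite connected quiver: finitely many vertices, finitely many arrows, at least one vertex,
and any two vertices are joined by a zigzag of arrows. Loops and parallel arrows are allowed. -/
structure FinQuiver where
  Vert : Type
  [quiver : Quiver.{0} Vert]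
  [fintypeVert : Fintype Vert]
  [fintypeHom : ∀ x y : Vert, Fintype (x ⟶ y)]
  [nonempty : Nonempty Vert]
  [connected : Subsingleton (Quiver.WeaklyConnectedComponent Vert)]

instance : CoeSort FinQuiver Type := ⟨FinQuiver.Vert⟩

attribute [instance] FinQuiver.quiver FinQuiver.fintypeVert FinQuiver.fintypeHom
  FinQuiver.nonempty FinQuiver.connected

/-- A finite-dimensional representation of the quiver `Q` over `K`. -/
structure QuiverRep (K : Type u) [Field K] (Q : FinQuiver) where
  space : Q → Type u
  [addCommGroup : ∀ x, AddCommGroup (space x)]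
  [module : ∀ x, Module K (space x)]
  [finite : ∀ x, Module.Finite K (space x)]
  map : ∀ {x y : Q}, (x ⟶ y) → (space x →ₗ[K] space y)

attribute [instance] QuiverRep.addCommGroup QuiverRep.module QuiverRep.finite

namespace QuiverRep

variable {K : Type u} [Field K] {Q Q' : FinQuiver}

/-- A family of subspaces which is a subrepresentation. -/
def IsSubrep (M : QuiverRep K Q) (W : ∀ x, Submodule K (M.space x)) : Prop :=
  ∀ ⦃x y : Q⦄ (a : x ⟶ y), (W x).map (M.map a) ≤ W y

/-- The representation given by a subrepresentation, by restricting the maps. -/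
def sub (M : QuiverRep K Q) (W : ∀ x, Submodule K (M.space x)) (h : M.IsSubrep W) :
    QuiverRep K Q where
  space x := W x
  map {_ _} a := (M.map a).restrict (fun _ hv => h a (Submodule.mem_map_of_mem hv))

/-- The quotient representation by a subrepresentation. -/
def quot (M : QuiverRep K Q) (W : ∀ x, Submodule K (M.space x)) (h : M.IsSubrep W) :
    QuiverRep K Q where
  space x := M.space x ⧸ W x
  map {x y} a := (W x).mapQ (W y) (M.map a) (Submodule.map_le_iff_le_comap.mp (h a))

/-! ### The global rank function -/

/-- `W` is a subrepresentation on which every arrow acts by an epimorphism `W x → W y`. -/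
def IsEpiSubrep (M : QuiverRep K Q) (W : ∀ x, Submodule K (M.space x)) : Prop :=
  ∀ ⦃x y : Q⦄ (a : x ⟶ y), (W x).map (M.map a) = W y

/-- `U` is a subrepresentation such that every arrow acts by an injective map
`M x / U x → M y / U y` on the quotient representation. -/
def IsMonoQuot (M : QuiverRep K Q) (U : ∀ x, Submodule K (M.space x)) : Prop :=
  ∀ ⦃x y : Q⦄ (a : x ⟶ y), (U y).comap (M.map a) = U x

/-- The largest subrepresentation in which every arrow acts by an epimorphism. -/
def epiPart (M : QuiverRep K Q) : ∀ x, Submodule K (M.space x) :=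
  sSup {W | M.IsEpiSubrep W}

/-- The kernel of the projection to the largest quotient in which every arrow acts injectively,
that is, the smallest `U` with `M.IsMonoQuot U`. -/
def monoKer (M : QuiverRep K Q) : ∀ x, Submodule K (M.space x) :=
  sInf {U | M.IsMonoQuot U}

theorem isGreatest_epiPart (M : QuiverRep K Q) :
    IsGreatest {W | M.IsEpiSubrep W} M.epiPart := by
  refine ⟨?_, fun W hW => le_sSup hW⟩
  intro x y a
  simp only [epiPart, sSup_apply, Submodule.map_iSup]
  exact iSup_congr fun W => W.2 a

theorem isLeast_monoKer (M : QuiverRep K Q) :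
    IsLeast {U | M.IsMonoQuot U} M.monoKer := by
  refine ⟨?_, fun U hU => sInf_le hU⟩
  intro x y a
  simp only [monoKer, sInf_apply, Submodule.comap_iInf]
  exact iInf_congr fun U => U.2 a

theorem isMonoQuot_iff (M : QuiverRep K Q) (U : ∀ x, Submodule K (M.space x)) :
    M.IsMonoQuot U ↔ ∃ h : M.IsSubrep U,
      ∀ ⦃x y : Q⦄ (a : x ⟶ y), Function.Injective ((M.quot U h).map a) := by
  constructor
  · intro hU
    refine ⟨fun x y a => Submodule.map_le_iff_le_comap.mpr (hU a).ge, fun x y a => ?_⟩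
    refine LinearMap.ker_eq_bot.mp ?_
    have := Submodule.ker_mapQ (U x) (U y) (M.map a) (hU a).ge
    refine this.trans ?_
    rw [hU a, Submodule.mkQ_map_self]
    rfl
  · rintro ⟨h, hinj⟩ x y a
    refine le_antisymm ?_ (Submodule.map_le_iff_le_comap.mp (h a))
    have h1 : LinearMap.ker ((U x).mapQ (U y) (M.map a)
      (Submodule.map_le_iff_le_comap.mp (h a))) = ⊥ := LinearMap.ker_eq_bot.mpr (hinj a)
    rw [Submodule.ker_mapQ] at h1
    rwa [← LinearMap.le_ker_iff_map, Submodule.ker_mkQ] at h1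

/-- The rank functor: the image of `epiPart M ↪ M ↠ M / monoKer M`, at each vertex. -/
def rankSpace (M : QuiverRep K Q) (x : Q) : Submodule K (M.space x ⧸ M.monoKer x) :=
  (M.epiPart x).map (M.monoKer x).mkQ

/-- The global rank of a representation: the common dimension of the spaces `rankSpace M x`
(see `finrank_rankSpace`). -/
noncomputable def globalRank (M : QuiverRep K Q) : ℕ :=
  Module.finrank K (M.rankSpace (Classical.arbitrary Q))

theorem finrank_rankSpace_of_hom (M : QuiverRep K Q) {x y : Q} (a : x ⟶ y) :
    Module.finrank K (M.rankSpace x) = Module.finrank K (M.rankSpace y) := by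
  have hU := M.isLeast_monoKer.1 a
  have hW := M.isGreatest_epiPart.1 a
  let g := (M.monoKer x).mapQ (M.monoKer y) (M.map a) hU.ge
  have hg : Function.Injective g := by
    refine LinearMap.ker_eq_bot.mp ?_
    refine (Submodule.ker_mapQ _ _ _ _).trans ?_
    rw [hU, Submodule.mkQ_map_self]
  have h1 : (M.rankSpace x).map g = M.rankSpace y := by
    rw [rankSpace, rankSpace, ← hW, ← Submodule.map_comp, ← Submodule.map_comp]
    rfl
  rw [← h1]
  exact ((M.rankSpace x).equivMapOfInjective g hg).finrank_eq

theorem finrank_rankSpace (M : QuiverRep K Q) (x : Q) :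
    Module.finrank K (M.rankSpace x) = M.globalRank := by
  obtain ⟨p⟩ := (Quiver.WeaklyConnectedComponent.eq (V := Q) x (Classical.arbitrary Q)).mp
    (Subsingleton.elim _ _)
  have key : ∀ (z : Q), @Quiver.Path (Quiver.Symmetrify Q) _ x z →
      Module.finrank K (M.rankSpace x) = Module.finrank K (M.rankSpace z) := by
    intro z p
    induction p with
    | nil => rfl
    | cons _ e ih =>
      rcases e with e | e
      · exact ih.trans (M.finrank_rankSpace_of_hom e)
      · exact ih.trans (M.finrank_rankSpace_of_hom e).symm
  exact key _ p

/-! ### Pullback, pushforward and rank functions -/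

/-- Pullback of a representation along a morphism of quivers. -/
def pullback (f : Q' ⥤q Q) (M : QuiverRep K Q) : QuiverRep K Q' where
  space x := M.space (f.obj x)
  map {_ _} a := M.map (f.map a)

open scoped Classical in
/-- Pushforward of a representation along a morphism of quivers. At a vertex `x` of the target
one has the (finite) direct sum of the spaces over the vertices above `x`; an arrow `a : x ⟶ x'`
acts by the sum of the maps of all the arrows `b` above `a`. -/
noncomputable def pushforward (f : Q' ⥤q Q) (M : QuiverRep K Q') : QuiverRep K Q where
  space x := ∀ y : {y : Q' // f.obj y = x}, M.space y.1
  map {x x'} a := LinearMap.pi fun y' : {y : Q' // f.obj y = x'} =>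
    ∑ y : {y : Q' // f.obj y = x},
      ∑ b : {b : y.1 ⟶ y'.1 // Quiver.homOfEq (f.map b) y.2 y'.2 = a},
        M.map b.1 ∘ₗ LinearMap.proj y

end QuiverRep

/-- The (additive) rank functions on a quiver: for a finite sequence of morphisms of quivers
starting at `Q`, in any directions, push forward or pull back along the successive morphisms,
and take the global rank at the end. -/
inductive IsRankFunction (K : Type u) [Field K] : (Q : FinQuiver) → (QuiverRep K Q → ℕ) → Prop
  | global (Q : FinQuiver) : IsRankFunction K Q QuiverRep.globalRank
  | push {Q Q' : FinQuiver} (f : Q ⥤q Q') {r : QuiverRep K Q' → ℕ} (hr : IsRankFunction K Q' r) :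
      IsRankFunction K Q (fun M => r (M.pushforward f))
  | pull {Q Q' : FinQuiver} (f : Q' ⥤q Q) {r : QuiverRep K Q' → ℕ} (hr : IsRankFunction K Q' r) :
      IsRankFunction K Q (fun M => r (M.pullback f))

/-! ### Representation spaces, Grassmannians, the subrepresentation bundle -/

/-- The representation space of `Q` of dimension vector `α`. -/
abbrev RepSpace (K : Type u) [Field K] (Q : FinQuiver) (α : Q → ℕ) : Type u :=
  ∀ ⦃x y : Q⦄, (x ⟶ y) → ((Fin (α x) → K) →ₗ[K] (Fin (α y) → K))

/-- A point of the representation space, as a representation. -/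
def RepSpace.toRep {K : Type u} [Field K] {Q : FinQuiver} {α : Q → ℕ} (φ : RepSpace K Q α) :
    QuiverRep K Q where
  space x := Fin (α x) → K
  map {_ _} a := φ a

/-- The product over the vertices `x` of the classical Grassmannians of `β x`-dimensional
subspaces of `K ^ α x`. -/
def Gr (K : Type u) [Field K] (Q : FinQuiver) (α β : Q → ℕ) : Type u :=
  {W : ∀ x : Q, Submodule K (Fin (α x) → K) // ∀ x, Module.finrank K (W x) = β x}

namespace Gr

variable {K : Type u} [Field K] {Q : FinQuiver} {α β : Q → ℕ}

/-- For each vertex `x`, the rows of `F x` form a basis of `W x`. (They are independent, since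
there are `dim (W x)` of them and they span `W x`.) -/
def IsFrame (W : Gr K Q α β) (F : ∀ x : Q, Matrix (Fin (β x)) (Fin (α x)) K) : Prop :=
  ∀ x, Submodule.span K (Set.range (F x)) = W.1 x

/-- Indices of the Plücker coordinates: a vertex `x` and a list of `β x` indices in `Fin (α x)`. -/
abbrev PluckerIndex (Q : FinQuiver) (α β : Q → ℕ) : Type :=
  Σ x : Q, (Fin (β x) → Fin (α x))

/-- The Plücker coordinates of a frame: the maximal minors of the matrices `F x`. -/
def plucker (F : ∀ x : Q, Matrix (Fin (β x)) (Fin (α x)) K) (i : PluckerIndex Q α β) : K :=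
  ((F i.1).submatrix id i.2).det

open scoped Classical in
/-- A polynomial in the Plücker coordinates which is homogeneous of some degree in the
coordinates that belong to `x`, for each vertex `x` separately. -/
def IsMultihomogeneous (P : MvPolynomial (PluckerIndex Q α β) K) : Prop :=
  ∃ d : Q → ℕ,
    MvPolynomial.IsWeightedHomogeneous
      (fun i : PluckerIndex Q α β => (Pi.single i.1 1 : Q → ℕ)) P d

/-- The points at which a multihomogeneous polynomial in the Plücker coordinates does not vanish
(a condition that does not depend on the frame). -/
def basicOpen (P : MvPolynomial (PluckerIndex Q α β) K) : Set (Gr K Q α β) :=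
  {W | ∃ F, W.IsFrame F ∧ MvPolynomial.eval (plucker F) P ≠ 0}

/-- The Zariski topology on the product of Grassmannians, embedded in a product of projective
spaces by the Plücker coordinates: the open sets are the unions of the sets where
multihomogeneous polynomials do not vanish. -/
instance : TopologicalSpace (Gr K Q α β) :=
  TopologicalSpace.generateFrom {U | ∃ P, IsMultihomogeneous P ∧ U = basicOpen P}

end Gr

/-- The bundle of `β`-dimensional subrepresentations over the representation space. -/
def SubrepBundle (K : Type u) [Field K] (Q : FinQuiver) (α β : Q → ℕ) :
    Set (Gr K Q α β × RepSpace K Q α) :=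
  {p | p.2.toRep.IsSubrep p.1.1}

/-- The quiver Grassmannian `Gr(φ, β)`: the fibre over `φ` of the bundle of `β`-dimensional
subrepresentations, with the Zariski topology that it has as a subset of the product of
Grassmannians. -/
abbrev QuiverGr {K : Type u} [Field K] {Q : FinQuiver} {α : Q → ℕ} (φ : RepSpace K Q α)
    (β : Q → ℕ) : Type u :=
  {W : Gr K Q α β // (W, φ) ∈ SubrepBundle K Q α β}

namespace QuiverGr

variable {K : Type u} [Field K] {Q : FinQuiver} {α β : Q → ℕ} {φ : RepSpace K Q α}

/-- The restriction of `φ` to the subrepresentation `W`. -/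
def subrep (W : QuiverGr φ β) : QuiverRep K Q := φ.toRep.sub W.1.1 W.2

/-- The quotient of `φ` by the subrepresentation `W`. -/
def quotrep (W : QuiverGr φ β) : QuiverRep K Q := φ.toRep.quot W.1.1 W.2

/-- A rank locus in `Gr(φ, β)`: the points `W` which satisfy a finite list of linear inequalities
(weak, or strict for the indices in `strict`) in the values of finitely many rank functions at
the subrepresentation `W` and at the quotient of `φ` by `W`. -/
def IsRankLocus (S : Set (QuiverGr φ β)) : Prop :=
  ∃ (m n : ℕ) (r : Fin m → QuiverRep K Q → ℕ) (a b : Fin n → Fin m → ℝ) (c : Fin n → ℝ)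
    (strict : Set (Fin n)),
    (∀ i, IsRankFunction K Q (r i)) ∧
    ∀ W : QuiverGr φ β, W ∈ S ↔ ∀ l,
      ∑ i, (a l i * r i W.subrep + b l i * r i W.quotrep) ≤ c l ∧
      (l ∈ strict → ∑ i, (a l i * r i W.subrep + b l i * r i W.quotrep) < c l)

end QuiverGr

/-- Constructible subsets of a variety: those obtained from finitely many sets, each of which is
open or closed, by unions and intersections. -/
inductive IsConstructibleSubset {X : Type u} [TopologicalSpace X] : Set X → Prop
  | of_isOpen {s : Set X} : IsOpen s → IsConstructibleSubset s
  | of_isClosed {s : Set X} : IsClosed s → IsConstructibleSubset s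
  | union {s t : Set X} : IsConstructibleSubset s → IsConstructibleSubset t →
      IsConstructibleSubset (s ∪ t)
  | inter {s t : Set X} : IsConstructibleSubset s → IsConstructibleSubset t →
      IsConstructibleSubset (s ∩ t)

end RankLoci

/-! A rank function takes finitely many values on the fibre, so it is enough that its level sets are
constructible. Any condition on finitely many such numbers is then constructible, and the shape of
the inequalities plays no role (`IsConstructibleMap.preimage`).

The representations W and φ/W are regarded as families over the quiver Grassmannian, with sections
over the algebra C of functions that are rational in the Plücker coordinates on the pieces of a
finite constructible cover. Since C contains the indicators of its zero sets, case distinctions can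
be made inside C, and a linear equation over C is solved at all points at once by finitely many
sections (`isGenerated_ker_linearCombination`). Hence families of subspaces spanned pointwise by
finitely many sections are stable under sums, intersections, images and preimages
(`IsGenerated.inf_comap`), and their dimensions are constructible
(`IsGenerated.isConstructibleMap_finrank`).

Pullback reindexes such a family of representations and pushforward takes finite direct sums. The
epi part and the mono kernel arise by iterating these lattice operations, images and preimages; the
iteration stops after at most as many steps as the total dimension, which is bounded over the
family. So the global rank is the dimension of a finitely spanned family. The starting point is that
W itself is spanned by the rows of normalised frames, whose entries are ratios of Plücker
coordinates (`isGenerated_subspace`). -/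

namespace RankLoci

/-! ### Constructible subsets -/

namespace IsConstructibleSubset

variable {X : Type u} [TopologicalSpace X] {s t : Set X}

theorem compl (hs : IsConstructibleSubset s) : IsConstructibleSubset sᶜ := by
  induction hs with
  | of_isOpen h => exact of_isClosed h.isClosed_compl
  | of_isClosed h => exact of_isOpen h.isOpen_compl
  | union _ _ h₁ h₂ => rw [Set.compl_union]; exact h₁.inter h₂
  | inter _ _ h₁ h₂ => rw [Set.compl_inter]; exact h₁.union h₂

theorem univ : IsConstructibleSubset (Set.univ : Set X) := of_isOpen isOpen_univ

theorem empty : IsConstructibleSubset (∅ : Set X) := of_isOpen isOpen_empty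

theorem biUnion {ι : Type*} {A : Set ι} (hA : A.Finite) {S : ι → Set X}
    (hS : ∀ i ∈ A, IsConstructibleSubset (S i)) : IsConstructibleSubset (⋃ i ∈ A, S i) := by
  induction A, hA using Set.Finite.induction_on with
  | empty => simpa using empty
  | insert _ _ ih =>
    rw [Set.biUnion_insert]
    exact (hS _ (Set.mem_insert _ _)).union (ih fun i hi => hS i (Set.mem_insert_of_mem _ hi))

theorem iUnion {ι : Type*} [Finite ι] {S : ι → Set X} (hS : ∀ i, IsConstructibleSubset (S i)) :
    IsConstructibleSubset (⋃ i, S i) := by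
  simpa using biUnion (Set.finite_univ (α := ι)) (fun i _ => hS i)

theorem iInter {ι : Type*} [Finite ι] {S : ι → Set X} (hS : ∀ i, IsConstructibleSubset (S i)) :
    IsConstructibleSubset (⋂ i, S i) := by
  have := (iUnion fun i => (hS i).compl).compl
  simpa [Set.compl_iUnion] using this

end IsConstructibleSubset

/-- A map with finitely many values and constructible fibres. -/
structure IsConstructibleMap {X : Type u} [TopologicalSpace X] {T : Type*} (h : X → T) : Prop where
  finite_range : (Set.range h).Finite
  fiber : ∀ t, IsConstructibleSubset (h ⁻¹' {t})

namespace IsConstructibleMap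

variable {X : Type u} [TopologicalSpace X] {T : Type*}

theorem preimage {h : X → T} (hh : IsConstructibleMap h) (A : Set T) :
    IsConstructibleSubset (h ⁻¹' A) := by
  have : h ⁻¹' A = ⋃ t ∈ Set.range h ∩ A, h ⁻¹' {t} := by
    ext x
    simp
  rw [this]
  exact .biUnion (hh.finite_range.inter_of_left A) fun t _ => hh.fiber t

theorem pi {ι : Type*} [Finite ι] {h : ι → X → T} (hh : ∀ i, IsConstructibleMap (h i)) :
    IsConstructibleMap (fun x i => h i x) where
  finite_range := by
    refine (Set.Finite.pi' fun i => (hh i).finite_range).subset ?_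
    rintro _ ⟨x, rfl⟩ i
    exact ⟨x, rfl⟩
  fiber t := by
    have : (fun x i => h i x) ⁻¹' {t} = ⋂ i, h i ⁻¹' {t i} := by
      ext x
      simp [funext_iff]
    rw [this]
    exact .iInter fun i => (hh i).fiber _

theorem of_le {h : X → ℕ} (N : ℕ) (hN : ∀ x, h x ≤ N)
    (hh : ∀ k, IsConstructibleSubset {x | k ≤ h x}) : IsConstructibleMap h where
  finite_range := (Set.finite_Iic N).subset (by rintro _ ⟨x, rfl⟩; exact hN x)
  fiber k := by
    have : h ⁻¹' {k} = {x | k ≤ h x} ∩ {x | k + 1 ≤ h x}ᶜ := by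
      ext x
      change h x = k ↔ k ≤ h x ∧ ¬ k + 1 ≤ h x
      omega
    rw [this]
    exact (hh k).inter (hh (k + 1)).compl

end IsConstructibleMap

/-! ### Coherent families of vector spaces -/

open scoped Classical in
/-- An algebra of functions whose zero sets are constructible and which contains the indicator
functions of these zero sets. -/
structure IsConstructibleAlgebra {K X : Type u} [Field K] [TopologicalSpace X]
    (C : Subalgebra K (X → K)) : Prop where
  zeros : ∀ g ∈ C, IsConstructibleSubset {p | g p = 0}
  indicator : ∀ g ∈ C, (fun p => if g p = 0 then 1 else 0) ∈ C

section Families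

variable {K X : Type u} [Field K] {C : Subalgebra K (X → K)}
  {E : X → Type u} [∀ p, AddCommGroup (E p)] [∀ p, Module K (E p)]
  {E' : X → Type u} [∀ p, AddCommGroup (E' p)] [∀ p, Module K (E' p)]

/-- A family of subspaces which is spanned by finitely many sections from `Γ`. -/
def IsGenerated (Γ : Submodule C (∀ p, E p)) (L : ∀ p, Submodule K (E p)) : Prop :=
  ∃ (ι : Type) (_ : Fintype ι) (s : ι → ∀ p, E p), (∀ i, s i ∈ Γ) ∧
    ∀ p, L p = Submodule.span K (Set.range fun i => s i p)

/-- The sections of a product of families with components in given spaces of sections. -/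
def piSections {Y : Type} {F : Y → X → Type u} [∀ y p, AddCommGroup (F y p)]
    [∀ y p, Module K (F y p)] (Γ : ∀ y, Submodule C (∀ p, F y p)) :
    Submodule C (∀ p, ∀ y, F y p) where
  carrier := {s | ∀ y, (fun p => s p y) ∈ Γ y}
  add_mem' hs ht y := (Γ y).add_mem (hs y) (ht y)
  zero_mem' y := (Γ y).zero_mem
  smul_mem' c _ hs y := (Γ y).smul_mem c (hs y)

variable (C) in
/-- The elements of `C` as sections of the constant family `K`. -/
def lineSections : Submodule C (∀ _ : X, K) where
  carrier := {s | s ∈ C}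
  add_mem' hs ht := C.add_mem hs ht
  zero_mem' := C.zero_mem
  smul_mem' c _ hs := C.mul_mem c.2 hs

variable (C) in
/-- The sections of the constant family `ι → K` with coordinates in `C`. -/
abbrev coordSections (ι : Type) : Submodule C (∀ _ : X, ι → K) :=
  piSections fun _ => lineSections C

/-- A space of sections `Γ` which generates the family and such that the linear relations between
finitely many sections in `Γ` are generated by relations with coefficients in `C`. -/
structure IsCoherent (Γ : Submodule C (∀ p, E p)) : Prop where
  top : IsGenerated Γ (fun _ => ⊤)
  syz : ∀ (ι : Type) [Fintype ι] (t : ι → ∀ p, E p), (∀ i, t i ∈ Γ) →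
    IsGenerated (coordSections C ι)
      (fun p => LinearMap.ker (Fintype.linearCombination K (fun i => t i p)))

theorem sum_smul_mem (Γ : Submodule C (∀ p, E p)) {ι : Type} [Fintype ι] {t : ι → ∀ p, E p}
    (ht : ∀ i, t i ∈ Γ) {c : X → ι → K} (hc : c ∈ coordSections C ι) :
    (fun p => Fintype.linearCombination K (fun i => t i p) (c p)) ∈ Γ := by
  have : (fun p => Fintype.linearCombination K (fun i => t i p) (c p)) =
      ∑ i, (⟨fun p => c p i, hc i⟩ : C) • t i := by
    funext p
    rw [Fintype.linearCombination_apply, Finset.sum_apply]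
    rfl
  rw [this]
  exact Γ.sum_mem fun i _ => Γ.smul_mem _ (ht i)

/-! ### Operations on finitely generated families of subspaces. -/

namespace IsGenerated

variable {Γ : Submodule C (∀ p, E p)} {Γ' : Submodule C (∀ p, E' p)}
  {L L' : ∀ p, Submodule K (E p)}

theorem of_finite {ι : Type*} [Finite ι] (s : ι → ∀ p, E p) (hs : ∀ i, s i ∈ Γ)
    (hL : ∀ p, L p = Submodule.span K (Set.range fun i => s i p)) : IsGenerated Γ L := by
  refine ⟨Fin (Nat.card ι), inferInstance, s ∘ (Finite.equivFin ι).symm, fun i => hs _,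
    fun p => ?_⟩
  rw [hL]
  congr 1
  exact ((Finite.equivFin ι).symm.surjective.range_comp (fun i => s i p)).symm

theorem map (hL : IsGenerated Γ L) (f : ∀ p, E p →ₗ[K] E' p)
    (hf : ∀ s ∈ Γ, (fun p => f p (s p)) ∈ Γ') :
    IsGenerated Γ' (fun p => (L p).map (f p)) := by
  obtain ⟨ι, _, s, hs, h⟩ := hL
  refine ⟨ι, inferInstance, fun i p => f p (s i p), fun i => hf _ (hs i), fun p => ?_⟩
  beta_reduce
  rw [h, Submodule.map_span, ← Set.range_comp]
  rfl

theorem bot : IsGenerated Γ (fun _ => ⊥) :=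
  ⟨Empty, inferInstance, fun i => i.elim, fun i => i.elim, fun p => by
    rw [Set.range_eq_empty, Submodule.span_empty]⟩

theorem iSup {J : Type*} [Finite J] {L : J → ∀ p, Submodule K (E p)}
    (hL : ∀ j, IsGenerated Γ (L j)) : IsGenerated Γ (fun p => ⨆ j, L j p) := by
  choose ι _ s hs h using hL
  refine of_finite (ι := Σ j, ι j) (fun i => s i.1 i.2) (fun i => hs _ _) fun p => ?_
  simp_rw [h, ← Submodule.span_iUnion]
  congr 1
  ext v
  simp

theorem sup (hL : IsGenerated Γ L) (hL' : IsGenerated Γ L') :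
    IsGenerated Γ (fun p => L p ⊔ L' p) := by
  have := iSup (Γ := Γ) (J := Bool) (L := fun b => bif b then L else L')
    (by rintro (_ | _) <;> assumption)
  simpa [iSup_bool_eq] using this

/-- A combination of the generators `s i` of `L` is mapped into `N` exactly when its coefficients
extend to a linear relation between the `f (s i)` and the generators `t j` of `N`. Coherence of the
target makes these relations finitely generated. -/
theorem inf_comap (hΓ' : IsCoherent Γ') (hL : IsGenerated Γ L) {N : ∀ p, Submodule K (E' p)}
    (hN : IsGenerated Γ' N) (f : ∀ p, E p →ₗ[K] E' p)
    (hf : ∀ s ∈ Γ, (fun p => f p (s p)) ∈ Γ') :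
    IsGenerated Γ (fun p => L p ⊓ (N p).comap (f p)) := by
  obtain ⟨ι, _, s, hs, h⟩ := hL
  obtain ⟨κ, _, t, ht, h'⟩ := hN
  have key := hΓ'.syz (ι ⊕ κ) (Sum.elim (fun i p => f p (s i p)) t)
    (by rintro (i | i); exacts [hf _ (hs i), ht i])
  -- The zeros discard the coefficients of the `t j`: a relation is sent to the element of `L` given
  -- by its first half.
  have := key.map (Γ' := Γ)
    (fun p => Fintype.linearCombination K
      (fun i => (Sum.elim s 0 : ι ⊕ κ → ∀ p, E p) i p))
    (fun c hc => sum_smul_mem Γ (by rintro (i | i); exacts [hs i, Γ.zero_mem]) hc)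
  convert this using 2 with p
  ext v
  simp only [Submodule.mem_inf, Submodule.mem_comap, Submodule.mem_map, LinearMap.mem_ker,
    Fintype.linearCombination_apply, Fintype.sum_sum_type, Sum.elim_inl, Sum.elim_inr, h, h',
    Submodule.mem_span_range_iff_exists_fun, Pi.zero_apply, smul_zero, Finset.sum_const_zero,
    add_zero]
  constructor
  · rintro ⟨⟨c, rfl⟩, d, hd⟩
    refine ⟨Sum.elim c (-d), ?_, by simp⟩
    simp [hd]
  · rintro ⟨c, hc, rfl⟩
    refine ⟨⟨_, rfl⟩, fun j => - c (Sum.inr j), ?_⟩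
    simp only [neg_smul, Finset.sum_neg_distrib, map_sum, map_smul]
    exact (eq_neg_of_add_eq_zero_left hc).symm

theorem inf (hΓ : IsCoherent Γ) (hL : IsGenerated Γ L) (hL' : IsGenerated Γ L') :
    IsGenerated Γ (fun p => L p ⊓ L' p) := by
  simpa using hL.inf_comap hΓ hL' (fun _ => LinearMap.id) (fun _ h => h)

theorem comap (hΓ : IsCoherent Γ) (hΓ' : IsCoherent Γ') {N : ∀ p, Submodule K (E' p)}
    (hN : IsGenerated Γ' N) (f : ∀ p, E p →ₗ[K] E' p)
    (hf : ∀ s ∈ Γ, (fun p => f p (s p)) ∈ Γ') :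
    IsGenerated Γ (fun p => (N p).comap (f p)) := by
  simpa using hΓ.top.inf_comap hΓ' hN f hf

theorem finset_inf (hΓ : IsGenerated Γ fun _ => ⊤)
    (hinf : ∀ L L' : ∀ p, Submodule K (E p), IsGenerated Γ L → IsGenerated Γ L' →
      IsGenerated Γ (fun p => L p ⊓ L' p)) {J : Type*} {L : J → ∀ p, Submodule K (E p)}
    (hL : ∀ j, IsGenerated Γ (L j)) (A : Finset J) : IsGenerated Γ (fun p => ⨅ j ∈ A, L j p) := by
  classical
  induction A using Finset.induction_on with
  | empty => simpa using hΓ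
  | insert a A _ ih => simpa only [Finset.iInf_insert] using hinf _ _ (hL a) ih

theorem iInf (hΓ : IsCoherent Γ) {J : Type*} [Finite J] {L : J → ∀ p, Submodule K (E p)}
    (hL : ∀ j, IsGenerated Γ (L j)) : IsGenerated Γ (fun p => ⨅ j, L j p) := by
  have := Fintype.ofFinite J
  simpa using finset_inf hΓ.top (fun _ _ h h' => h.inf hΓ h') hL Finset.univ

end IsGenerated

/-! ### Coherence of constant families. -/

theorem single_mem_coordSections {ι : Type} [DecidableEq ι] (i : ι) {c : X → K} (hc : c ∈ C) :
    (fun p => Pi.single i (c p)) ∈ coordSections C ι := by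
  intro j
  by_cases h : j = i
  · subst h
    simp only [Pi.single_eq_same]
    exact hc
  · simp only [Pi.single_eq_of_ne h]
    exact C.zero_mem

theorem isGenerated_coordSections_top (ι : Type) [Fintype ι] :
    IsGenerated (coordSections C ι) (fun _ => ⊤) := by
  classical
  refine ⟨ι, inferInstance, fun i _ => Pi.single i 1,
    fun i => single_mem_coordSections i C.one_mem, fun p => ?_⟩
  have h := (Pi.basisFun K ι).span_eq
  rw [funext (Pi.basisFun_apply K ι)] at h
  exact h.symm

/-- Where some `t j` is nonzero, the Koszul relations span the kernel. Where all of them vanish, the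
kernel is everything and the unit vectors are needed; these are switched on by the product of the
indicators of `t j = 0` and vanish elsewhere. -/
theorem isGenerated_ker_linearCombination [TopologicalSpace X] (hC : IsConstructibleAlgebra C)
    {ι : Type} [Fintype ι] {t : ι → X → K} (ht : ∀ i, t i ∈ C) :
    IsGenerated (coordSections C ι)
      (fun p => LinearMap.ker (Fintype.linearCombination K (fun i => t i p))) := by
  classical
  refine IsGenerated.of_finite (ι := ι × ι ⊕ ι)
    (Sum.elim (fun e p => Pi.single e.1 (t e.2 p) - Pi.single e.2 (t e.1 p))
      (fun i p => Pi.single i (∏ j, if t j p = 0 then (1 : K) else 0))) ?_ fun p => ?_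
  · rintro (⟨i, j⟩ | i)
    · exact (coordSections C ι).sub_mem (single_mem_coordSections i (ht j))
        (single_mem_coordSections j (ht i))
    · refine single_mem_coordSections i ?_
      have := C.prod_mem (t := Finset.univ) fun j (_ : j ∈ Finset.univ) => hC.indicator _ (ht j)
      convert this using 1
      funext p
      simp
  · apply le_antisymm
    · intro d hd
      simp only [LinearMap.mem_ker, Fintype.linearCombination_apply, smul_eq_mul] at hd
      have hsum : d = ∑ i, Pi.single i (d i) := (Finset.univ_sum_single d).symm
      by_cases h : ∃ j, t j p ≠ 0
      · obtain ⟨j, hj⟩ := h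
        -- Dividing by `t j p` recovers `d` from the first terms; the second terms add up to a
        -- multiple of `∑ i, d i * t i p`, which is zero.
        have : d = ∑ i, (d i * (t j p)⁻¹) • (Pi.single i (t j p) - Pi.single j (t i p)) := by
          simp only [smul_sub, ← Pi.single_smul, smul_eq_mul, Finset.sum_sub_distrib]
          have h2 : ∑ i, (Pi.single j (d i * (t j p)⁻¹ * t i p) : ι → K) = 0 := by
            rw [← Pi.single_zero j]
            have := (map_sum (AddMonoidHom.single (fun _ : ι => K) j)
              (fun i => d i * (t j p)⁻¹ * t i p) Finset.univ).symm
            refine this.trans ?_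
            simp_rw [mul_right_comm _ _ (t _ p), ← Finset.sum_mul, hd]
            simp
          rw [h2, sub_zero]
          simpa [mul_assoc, hj] using hsum
        rw [this]
        exact Submodule.sum_mem _ fun i _ => Submodule.smul_mem _ _
          (Submodule.subset_span ⟨Sum.inl (i, j), rfl⟩)
      · push Not at h
        rw [hsum]
        refine Submodule.sum_mem _ fun i _ => ?_
        have : Pi.single i (d i) = d i • (Pi.single i 1 : ι → K) := by
          rw [← Pi.single_smul]; simp
        rw [this]
        refine Submodule.smul_mem _ _ (Submodule.subset_span ⟨Sum.inr i, ?_⟩)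
        simp [h]
    · rw [Submodule.span_le]
      rintro _ ⟨⟨i, j⟩ | i, rfl⟩
      · simp [Fintype.linearCombination_apply_single, mul_comm]
      · simp only [Sum.elim_inr, SetLike.mem_coe, LinearMap.mem_ker,
          Fintype.linearCombination_apply_single, smul_eq_mul]
        by_cases h : t i p = 0
        · simp [h]
        · rw [Finset.prod_eq_zero (Finset.mem_univ i) (by simp [h]), zero_mul]

theorem isCoherent_lineSections [TopologicalSpace X] (hC : IsConstructibleAlgebra C) :
    IsCoherent (lineSections C) where
  top := by
    refine ⟨Unit, inferInstance, fun _ _ => 1, fun _ => C.one_mem, fun p => ?_⟩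
    simp [Set.range_const, Ideal.submodule_span_eq]
  syz _ _ _ ht := isGenerated_ker_linearCombination hC ht

/-! ### Products, quotients and subfamilies of coherent families. -/

theorem IsCoherent.pi {Y : Type} [Finite Y] {F : Y → X → Type u} [∀ y p, AddCommGroup (F y p)]
    [∀ y p, Module K (F y p)] {Γ : ∀ y, Submodule C (∀ p, F y p)} (hΓ : ∀ y, IsCoherent (Γ y)) :
    IsCoherent (piSections Γ) where
  top := by
    classical
    have := Fintype.ofFinite Y
    have h := IsGenerated.iSup fun y => (hΓ y).top.map (Γ' := piSections Γ)
      (fun p => LinearMap.single K (fun y => F y p) y) (fun s hs z => by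
        by_cases h : z = y
        · subst h
          simpa only [LinearMap.single_apply, Pi.single_eq_same] using hs
        · simp only [LinearMap.single_apply, Pi.single_eq_of_ne h]
          exact (Γ z).zero_mem)
    convert h using 2 with p
    simp_rw [← LinearMap.range_eq_map]
    exact (LinearMap.iSup_range_single K (fun y => F y p)).symm
  syz ι _ t ht := by
    have := Fintype.ofFinite Y
    -- The components of a relation are imposed one at a time by `inf_comap` into the factor `Γ y`.
    -- A general intersection would require coherence of `coordSections C ι`, which is itself an
    -- instance of this lemma.
    suffices ∀ A : Finset Y, IsGenerated (coordSections C ι) (fun p => ⨅ y ∈ A,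
        LinearMap.ker (Fintype.linearCombination K (fun i => t i p y))) by
      convert this Finset.univ using 2 with p
      ext d
      simp [Fintype.linearCombination_apply, funext_iff]
    classical
    intro A
    induction A using Finset.induction_on with
    | empty => simpa using isGenerated_coordSections_top ι
    | insert y A _ ih =>
      have := ih.inf_comap (hΓ y) IsGenerated.bot
        (fun p => Fintype.linearCombination K (fun i => t i p y))
        (fun c hc => sum_smul_mem (Γ y) (t := fun i p => t i p y) (fun i => ht i y) hc)
      simpa only [Finset.iInf_insert, inf_comm, LinearMap.ker] using this

theorem isCoherent_coordSections [TopologicalSpace X] (hC : IsConstructibleAlgebra C)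
    (ι : Type) [Finite ι] : IsCoherent (coordSections C ι) :=
  .pi fun _ => isCoherent_lineSections hC

/-- The sections of a family of quotients which lift to `Γ`. -/
def quotSections (Γ : Submodule C (∀ p, E p)) (N : ∀ p, Submodule K (E p)) :
    Submodule C (∀ p, E p ⧸ N p) where
  carrier := {s | ∃ t ∈ Γ, ∀ p, s p = (N p).mkQ (t p)}
  add_mem' := by
    rintro _ _ ⟨t, ht, h⟩ ⟨t', ht', h'⟩
    exact ⟨t + t', Γ.add_mem ht ht', fun p => by simp [h, h']⟩
  zero_mem' := ⟨0, Γ.zero_mem, fun p => by simp⟩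
  smul_mem' := by
    rintro c _ ⟨t, ht, h⟩
    refine ⟨c • t, Γ.smul_mem c ht, fun p => ?_⟩
    exact (congrArg (c.1 p • ·) (h p)).trans (map_smul _ _ _).symm

theorem mkQ_mem_quotSections {Γ : Submodule C (∀ p, E p)} (N : ∀ p, Submodule K (E p))
    {s : ∀ p, E p} (hs : s ∈ Γ) : (fun p => (N p).mkQ (s p)) ∈ quotSections Γ N :=
  ⟨s, hs, fun _ => rfl⟩

/-- Relations between sections of the quotient are the coefficient vectors whose combination of the
lifts falls into `N`, so they form a preimage of a generated family. -/
theorem IsCoherent.quot {Γ : Submodule C (∀ p, E p)} (hΓ : IsCoherent Γ)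
    {N : ∀ p, Submodule K (E p)} (hN : IsGenerated Γ N) : IsCoherent (quotSections Γ N) where
  top := by
    simpa using hΓ.top.map (fun p => (N p).mkQ) (fun s hs => mkQ_mem_quotSections N hs)
  syz ι _ t ht := by
    choose t' ht' h using ht
    have := (isGenerated_coordSections_top ι).inf_comap hΓ hN
      (fun p => Fintype.linearCombination K (fun i => t' i p))
      (fun c hc => sum_smul_mem Γ ht' hc)
    convert this using 2 with p
    ext d
    have : ∑ i, d i • t i p = (N p).mkQ (∑ i, d i • t' i p) := by
      simp only [h, map_sum, map_smul]
    rw [LinearMap.mem_ker, Fintype.linearCombination_apply, this, ← LinearMap.mem_ker,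
      Submodule.ker_mkQ, top_inf_eq, Submodule.mem_comap, Fintype.linearCombination_apply]

/-- The sections of a family of subspaces which belong to `Γ`. -/
def subSections (Γ : Submodule C (∀ p, E p)) (L : ∀ p, Submodule K (E p)) :
    Submodule C (∀ p, L p) where
  carrier := {s | (fun p => (s p : E p)) ∈ Γ}
  add_mem' hs ht := Γ.add_mem hs ht
  zero_mem' := Γ.zero_mem
  smul_mem' c _ hs := Γ.smul_mem c hs

theorem IsCoherent.sub {Γ : Submodule C (∀ p, E p)} (hΓ : IsCoherent Γ)
    {L : ∀ p, Submodule K (E p)} (hL : IsGenerated Γ L) : IsCoherent (subSections Γ L) where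
  top := by
    obtain ⟨ι, _, s, hs, h⟩ := hL
    have hmem : ∀ i p, s i p ∈ L p := fun i p => by
      rw [h]; exact Submodule.subset_span ⟨i, rfl⟩
    refine ⟨ι, inferInstance, fun i p => ⟨s i p, hmem i p⟩, hs, fun p => ?_⟩
    apply Submodule.map_injective_of_injective (L p).injective_subtype
    rw [Submodule.map_span, ← Set.range_comp, Submodule.map_top, Submodule.range_subtype]
    exact h p
  syz ι _ t ht := by
    convert hΓ.syz ι (fun i p => (t i p : E p)) ht using 2 with p
    ext d
    simp [Fintype.linearCombination_apply, ← Submodule.coe_eq_zero]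

/-! ### Constructibility of dimensions. -/

theorem le_finrank_span_range_iff {V : Type*} [AddCommGroup V] [Module K V] {ι : Type*} [Fintype ι]
    (v : ι → V) (k : ℕ) :
    k ≤ Module.finrank K (Submodule.span K (Set.range v)) ↔
      ∃ A : Finset ι, k ≤ A.card ∧ LinearIndependent K (fun i : A => v i) := by
  classical
  have : FiniteDimensional K (Submodule.span K (Set.range v)) :=
    FiniteDimensional.span_of_finite K (Set.finite_range v)
  constructor
  · intro h
    obtain ⟨κ, a, ha, hspan, hli⟩ := exists_linearIndependent' K v
    have : Finite κ := Finite.of_injective a ha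
    have := Fintype.ofFinite κ
    refine ⟨Finset.univ.image a, ?_, ?_⟩
    · rw [Finset.card_image_of_injective _ ha, Finset.card_univ, ← finrank_span_eq_card hli, hspan]
      exact h
    · have e : LinearIndependent K (fun i : Set.range a => v i) :=
        (linearIndepOn_range_iff ha v).2 hli
      have he : ((Finset.univ.image a : Finset ι) : Set ι) = Set.range a := by simp
      exact e.comp (fun i : (Finset.univ.image a : Finset ι) =>
        (⟨i.1, he ▸ Finset.mem_coe.2 i.2⟩ : Set.range a))
        (fun i j hij => Subtype.ext (congrArg (fun z : Set.range a => z.1) hij))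
  · rintro ⟨A, hA, hli⟩
    refine hA.trans ?_
    rw [← Fintype.card_coe, ← finrank_span_eq_card hli]
    exact Submodule.finrank_mono (Submodule.span_mono (by rintro _ ⟨i, rfl⟩; exact ⟨i.1, rfl⟩))

/-- Dimension at least k means that at least k of the generators are independent, a finite union of
conditions. Independence says that all generating relations vanish, that is, that finitely many
functions in C are zero. -/
theorem IsGenerated.isConstructibleMap_finrank [TopologicalSpace X] (hC : IsConstructibleAlgebra C)
    {Γ : Submodule C (∀ p, E p)} (hΓ : IsCoherent Γ) {L : ∀ p, Submodule K (E p)}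
    (hL : IsGenerated Γ L) : IsConstructibleMap (fun p => Module.finrank K (L p)) := by
  obtain ⟨ι, _, s, hs, h⟩ := hL
  refine .of_le (Fintype.card ι) (fun p => ?_) fun k => ?_
  · rw [h]
    exact finrank_range_le_card _
  · have : {p | k ≤ Module.finrank K (L p)} =
        ⋃ A ∈ {A : Finset ι | k ≤ A.card}, {p | LinearIndependent K (fun i : A => s i p)} := by
      ext p
      rw [Set.mem_ofPred_eq, h, le_finrank_span_range_iff]
      simp
    rw [this]
    refine .biUnion (Set.toFinite _) fun A _ => ?_
    obtain ⟨κ, _, c, hc, hker⟩ := hΓ.syz A (fun i => s i) (fun i => hs i)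
    have : {p | LinearIndependent K (fun i : A => s i p)} = ⋂ e : κ × A, {p | c e.1 p e.2 = 0} := by
      ext p
      rw [Set.mem_ofPred_eq, linearIndependent_iff_injective_fintypeLinearCombination,
        ← LinearMap.ker_eq_bot, show LinearMap.ker _ = _ from hker p,
        Submodule.span_eq_bot, Set.forall_mem_range]
      simp [funext_iff]
    rw [this]
    exact .iInter fun e => hC.zeros _ (hc e.1 e.2)

end Families

/-! ### The epi part and the mono kernel by iteration -/

/-- Each step that moves the point lowers `μ` by at least one, so at most `μ a` steps can move it.
-/
theorem isFixedPt_iterate_of_lt {α : Type*} (μ : α → ℕ) (F : α → α)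
    (h : ∀ a, F a ≠ a → μ (F a) < μ a) (N : ℕ) (a : α) (hN : μ a ≤ N) :
    F (F^[N] a) = F^[N] a := by
  induction N generalizing a with
  | zero =>
    by_contra hne
    have := h a hne
    omega
  | succ N ih =>
    by_cases hne : F a = a
    · rw [Function.iterate_fixed hne, hne]
    · have := h a hne
      exact ih (F a) (by omega)

namespace QuiverRep

variable {K : Type u} [Field K] {Q : FinQuiver} (M : QuiverRep K Q)

/-- Shrinks a family of subspaces towards the epi part. -/
def epiStep (W : ∀ x, Submodule K (M.space x)) (x : Q) : Submodule K (M.space x) :=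
  W x ⊓ ((⨅ e : Σ y, (x ⟶ y), (W e.1).comap (M.map e.2)) ⊓
    ⨅ e : Σ z, (z ⟶ x), (W e.1).map (M.map e.2))

/-- Enlarges a family of subspaces towards the mono kernel. -/
def monoStep (W : ∀ x, Submodule K (M.space x)) (x : Q) : Submodule K (M.space x) :=
  W x ⊔ ((⨆ e : Σ y, (x ⟶ y), (W e.1).comap (M.map e.2)) ⊔
    ⨆ e : Σ z, (z ⟶ x), (W e.1).map (M.map e.2))

theorem epiStep_le (W : ∀ x, Submodule K (M.space x)) : M.epiStep W ≤ W := fun _ => inf_le_left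

theorem le_monoStep (W : ∀ x, Submodule K (M.space x)) : W ≤ M.monoStep W := fun _ => le_sup_left

theorem monotone_epiStep : Monotone M.epiStep := fun _ _ h x =>
  inf_le_inf (h x) (inf_le_inf (iInf_mono fun e => Submodule.comap_mono (h e.1))
    (iInf_mono fun e => Submodule.map_mono (h e.1)))

theorem monotone_monoStep : Monotone M.monoStep := fun _ _ h x =>
  sup_le_sup (h x) (sup_le_sup (iSup_mono fun e => Submodule.comap_mono (h e.1))
    (iSup_mono fun e => Submodule.map_mono (h e.1)))

/-- The meet of preimages encodes that arrows map `W` into itself, the meet of images that they map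
onto it. -/
theorem epiStep_eq_self_iff {W : ∀ x, Submodule K (M.space x)} :
    M.epiStep W = W ↔ M.IsEpiSubrep W := by
  rw [le_antisymm_iff, and_iff_right (M.epiStep_le W)]
  simp only [Pi.le_def, epiStep, le_inf_iff, le_iInf_iff, le_refl, true_and, Sigma.forall]
  constructor
  · intro h x y a
    exact le_antisymm (Submodule.map_le_iff_le_comap.2 ((h x).1 y a)) ((h y).2 x a)
  · exact fun h x => ⟨fun y a => Submodule.map_le_iff_le_comap.1 (h a).le, fun z a => (h a).ge⟩

theorem monoStep_eq_self_iff {W : ∀ x, Submodule K (M.space x)} :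
    M.monoStep W = W ↔ M.IsMonoQuot W := by
  rw [le_antisymm_iff, and_iff_left (M.le_monoStep W)]
  simp only [Pi.le_def, monoStep, sup_le_iff, iSup_le_iff, le_refl, true_and, Sigma.forall]
  constructor
  · intro h x y a
    exact le_antisymm ((h x).1 y a) (Submodule.map_le_iff_le_comap.1 ((h y).2 x a))
  · exact fun h x => ⟨fun y a => (h a).le, fun z a => Submodule.map_le_iff_le_comap.2 (h a).ge⟩

theorem sum_finrank_strictMono :
    StrictMono (fun W : ∀ x, Submodule K (M.space x) => ∑ x, Module.finrank K (W x)) := by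
  intro W W' h
  obtain ⟨hle, x, hx⟩ := Pi.lt_def.1 h
  exact Finset.sum_lt_sum (fun x _ => Submodule.finrank_mono (hle x))
    ⟨x, Finset.mem_univ x, Submodule.finrank_lt_finrank_of_lt hx⟩

/-- The epi part is the largest fixed point of a monotone decreasing operator. Any bound `N` on the
total dimension will do, so that one number of steps can serve a whole family. -/
theorem epiPart_eq_iterate {N : ℕ} (hN : ∑ x, Module.finrank K (M.space x) ≤ N) :
    M.epiPart = M.epiStep^[N] ⊤ := by
  have hE : M.epiStep M.epiPart = M.epiPart := M.epiStep_eq_self_iff.2 M.isGreatest_epiPart.1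
  apply le_antisymm
  · rw [← Function.iterate_fixed hE N]
    exact M.monotone_epiStep.iterate N le_top
  · refine M.isGreatest_epiPart.2 (M.epiStep_eq_self_iff.1 ?_)
    refine isFixedPt_iterate_of_lt
      (fun W : ∀ x, Submodule K (M.space x) => ∑ x, Module.finrank K (W x)) _
      (fun W hW => M.sum_finrank_strictMono (lt_of_le_of_ne (M.epiStep_le W) hW)) N _ ?_
    simpa using hN

theorem monoKer_eq_iterate {N : ℕ} (hN : ∑ x, Module.finrank K (M.space x) ≤ N) :
    M.monoKer = M.monoStep^[N] ⊥ := by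
  have hU : M.monoStep M.monoKer = M.monoKer := M.monoStep_eq_self_iff.2 M.isLeast_monoKer.1
  apply le_antisymm
  · refine M.isLeast_monoKer.2 (M.monoStep_eq_self_iff.1 ?_)
    -- The iteration ascends, so the codimension relative to `N` is the decreasing quantity; the
    -- bound `N` keeps the truncated subtraction strictly decreasing.
    refine isFixedPt_iterate_of_lt (fun W : ∀ x, Submodule K (M.space x) =>
      N - ∑ x, Module.finrank K (W x)) _ (fun W hW => ?_) N _ (Nat.sub_le _ _)
    have h := M.sum_finrank_strictMono (lt_of_le_of_ne (M.le_monoStep W) hW.symm)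
    have h' : ∑ x, Module.finrank K (M.monoStep W x) ≤ N :=
      (Finset.sum_le_sum fun x _ => Submodule.finrank_le _).trans hN
    simp only at h
    omega
  · rw [← Function.iterate_fixed hU N]
    exact M.monotone_monoStep.iterate N bot_le

end QuiverRep

/-! ### Coherent families of representations -/

section RepFamilies

variable {K X : Type u} [Field K] {C : Subalgebra K (X → K)} {Q Q' : FinQuiver}

/-- A family of representations with coherent spaces of sections at the vertices which are
respected by the arrows. -/
def IsCoherentFamily (C : Subalgebra K (X → K)) (M : X → QuiverRep K Q) : Prop :=
  ∃ Γ : ∀ x, Submodule C (∀ p, (M p).space x), (∀ x, IsCoherent (Γ x)) ∧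
    ∀ ⦃x y : Q⦄ (a : x ⟶ y), ∀ s ∈ Γ x, (fun p => (M p).map a (s p)) ∈ Γ y

namespace IsCoherentFamily

variable {M : X → QuiverRep K Q}

theorem pullback (hM : IsCoherentFamily C M) (f : Q' ⥤q Q) :
    IsCoherentFamily C (fun p => (M p).pullback f) := by
  obtain ⟨Γ, h, h'⟩ := hM
  exact ⟨fun x => Γ (f.obj x), fun x => h _, fun x y a => h' (f.map a)⟩

theorem pushforward (hM : IsCoherentFamily C M) (f : Q ⥤q Q') :
    IsCoherentFamily C (fun p => (M p).pushforward f) := by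
  classical
  obtain ⟨Γ, h, h'⟩ := hM
  refine ⟨fun x => piSections fun y : {y : Q // f.obj y = x} => Γ y.1, fun x => .pi fun y => h _,
    fun x x' a s hs y' => ?_⟩
  have key : (fun p => ((M p).pushforward f).map a (s p) y') =
      ∑ y : {y : Q // f.obj y = x}, ∑ b : {b : y.1 ⟶ y'.1 //
        Quiver.homOfEq (f.map b) y.2 y'.2 = a}, fun p => (M p).map b.1 (s p y) := by
    funext p
    simp only [Finset.sum_apply]
    refine (LinearMap.sum_apply _ _ _).trans (Finset.sum_congr rfl fun y _ => ?_)
    exact (LinearMap.sum_apply _ _ _)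
  rw [key]
  exact Submodule.sum_mem _ fun y _ => Submodule.sum_mem _ fun b _ => h' b.1 _ (hs y)

theorem isConstructibleMap_globalRank [TopologicalSpace X] (hC : IsConstructibleAlgebra C)
    (hM : IsCoherentFamily C M) : IsConstructibleMap (fun p => (M p).globalRank) := by
  obtain ⟨Γ, h, h'⟩ := hM
  -- The number of generating sections bounds the dimensions of the fibres uniformly in `p`.
  have hbound : ∃ N, ∀ p, ∑ x, Module.finrank K ((M p).space x) ≤ N := by
    choose ι _ s _ hs using fun x => (h x).top
    refine ⟨∑ x, Fintype.card (ι x), fun p => Finset.sum_le_sum fun x _ => ?_⟩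
    rw [← finrank_top, show ⊤ = _ from hs x p]
    exact finrank_range_le_card _
  obtain ⟨N, hN⟩ := hbound
  have hE : ∀ x, IsGenerated (Γ x) (fun p => (M p).epiPart x) := by
    simp_rw [fun p => (M p).epiPart_eq_iterate (hN p)]
    generalize N = n
    induction n with
    | zero => exact fun x => (h x).top
    | succ n ih =>
      intro x
      simp_rw [Function.iterate_succ_apply']
      exact (ih x).inf (h x) (.inf (h x)
        (.iInf (h x) fun e => .comap (h x) (h e.1) (ih e.1) _ (h' e.2))
        (.iInf (h x) fun e => (ih e.1).map _ (h' e.2)))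
  have hU : ∀ x, IsGenerated (Γ x) (fun p => (M p).monoKer x) := by
    simp_rw [fun p => (M p).monoKer_eq_iterate (hN p)]
    generalize N = n
    induction n with
    | zero => exact fun x => .bot
    | succ n ih =>
      intro x
      simp_rw [Function.iterate_succ_apply']
      exact (ih x).sup (.sup
        (.iSup fun e => .comap (h x) (h e.1) (ih e.1) _ (h' e.2))
        (.iSup fun e => (ih e.1).map _ (h' e.2)))
  let x₀ : Q := Classical.arbitrary Q
  exact ((hE x₀).map (fun p => ((M p).monoKer x₀).mkQ)
    (fun s hs => mkQ_mem_quotSections _ hs)).isConstructibleMap_finrank hC ((h x₀).quot (hU x₀))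

end IsCoherentFamily

theorem IsRankFunction.isConstructibleMap [TopologicalSpace X] (hC : IsConstructibleAlgebra C)
    {r : QuiverRep K Q → ℕ} (hr : IsRankFunction K Q r) {M : X → QuiverRep K Q}
    (hM : IsCoherentFamily C M) : IsConstructibleMap (fun p => r (M p)) := by
  induction hr with
  | global Q => exact hM.isConstructibleMap_globalRank hC
  | push f _ ih => exact ih (hM.pushforward f)
  | pull f _ ih => exact ih (hM.pullback f)

end RepFamilies

end RankLoci

namespace RankLoci

/-! ### Row spans and maximal minors of matrices. -/

theorem span_range_mul_le {K : Type*} [Field K] {m n l : Type*} [Fintype m] (G : Matrix l m K)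
    (F : Matrix m n K) :
    Submodule.span K (Set.range (G * F)) ≤ Submodule.span K (Set.range F) := by
  rw [Submodule.span_le]
  rintro _ ⟨i, rfl⟩
  have : (G * F) i = ∑ k, G i k • F k := by
    funext j
    simp [Matrix.mul_apply]
  rw [this]
  exact Submodule.sum_mem _ fun k _ => Submodule.smul_mem _ _ (Submodule.subset_span ⟨k, rfl⟩)

theorem exists_eq_mul_of_span_le {K : Type*} [Field K] {m n l : Type*} [Fintype m]
    {F : Matrix m n K} {F' : Matrix l n K}
    (h : Submodule.span K (Set.range F') ≤ Submodule.span K (Set.range F)) :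
    ∃ G : Matrix l m K, F' = G * F := by
  have (i : l) : ∃ c : m → K, ∑ k, c k • F k = F' i :=
    Submodule.mem_span_range_iff_exists_fun K |>.1 (h (Submodule.subset_span ⟨i, rfl⟩))
  choose G hG using this
  refine ⟨G, ?_⟩
  ext i j
  refine (congrFun (hG i) j).symm.trans ((Finset.sum_apply _ _ _).trans ?_)
  exact (Matrix.mul_apply (M := G) (N := F)).symm

theorem exists_submatrix_det_ne_zero {K : Type*} [Field K] {m n : ℕ}
    {F : Matrix (Fin m) (Fin n) K} (hF : LinearIndependent K F.row) :
    ∃ I : Fin m → Fin n, (F.submatrix id I).det ≠ 0 := by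
  -- Row rank equals column rank, so m independent columns can be selected.
  have hr : m ≤ Module.finrank K (Submodule.span K (Set.range F.col)) := by
    rw [← Matrix.rank_eq_finrank_span_cols, hF.rank_matrix, Fintype.card_fin]
  obtain ⟨A, hA, hli⟩ := (le_finrank_span_range_iff F.col m).1 hr
  let e : Fin m → A := fun i => A.equivFin.symm (Fin.castLE hA i)
  have he : Function.Injective e := A.equivFin.symm.injective.comp (Fin.castLE_injective hA)
  refine ⟨fun i => (e i).1, ?_⟩
  rw [← isUnit_iff_ne_zero, ← Matrix.isUnit_iff_isUnit_det,
    ← Matrix.linearIndependent_cols_iff_isUnit]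
  exact hli.comp e he

/-! ### Frames and multihomogeneous polynomials in the Plücker coordinates. -/

namespace Gr

variable {K : Type u} [Field K] {Q : FinQuiver} {α β : Q → ℕ}

theorem exists_isFrame (W : Gr K Q α β) : ∃ F, W.IsFrame F := by
  refine ⟨fun x i => (Module.finBasisOfFinrankEq K (W.1 x) (W.2 x) i : Fin (α x) → K),
    fun x => ?_⟩
  have h := congrArg (Submodule.map (W.1 x).subtype)
    (Module.finBasisOfFinrankEq K (W.1 x) (W.2 x)).span_eq
  rw [Submodule.map_span, ← Set.range_comp, Submodule.map_top, Submodule.range_subtype] at h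
  exact h

/-- A chosen frame. -/
noncomputable def frame (W : Gr K Q α β) : ∀ x : Q, Matrix (Fin (β x)) (Fin (α x)) K :=
  W.exists_isFrame.choose

theorem isFrame_frame (W : Gr K Q α β) : W.IsFrame W.frame := W.exists_isFrame.choose_spec

theorem IsFrame.linearIndependent {W : Gr K Q α β}
    {F : ∀ x : Q, Matrix (Fin (β x)) (Fin (α x)) K} (hF : W.IsFrame F) (x : Q) :
    LinearIndependent K (F x).row := by
  refine linearIndependent_iff_card_eq_finrank_span.2 ?_
  rw [Fintype.card_fin]
  exact (W.2 x).symm.trans (congrArg (fun V : Submodule K (Fin (α x) → K) => Module.finrank K V)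
    (hF x).symm)

/-- The Plücker coordinates with respect to the chosen frame. -/
noncomputable def coord (W : Gr K Q α β) : PluckerIndex Q α β → K := plucker W.frame

open scoped Classical in
/-- Multihomogeneous polynomials of multidegree `d` in the Plücker coordinates. -/
abbrev HasMultidegree (P : MvPolynomial (PluckerIndex Q α β) K) (d : Q → ℕ) : Prop :=
  MvPolynomial.IsWeightedHomogeneous
    (fun i : PluckerIndex Q α β => (Pi.single i.1 1 : Q → ℕ)) P d

theorem HasMultidegree.eval_mul {P : MvPolynomial (PluckerIndex Q α β) K} {d : Q → ℕ}
    (hP : HasMultidegree P d) (c : Q → K) (v : PluckerIndex Q α β → K) :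
    MvPolynomial.eval (fun i => c i.1 * v i) P =
      (∏ x, c x ^ d x) * MvPolynomial.eval v P := by
  classical
  rw [MvPolynomial.eval_eq, MvPolynomial.eval_eq, Finset.mul_sum]
  refine Finset.sum_congr rfl fun m hm => ?_
  have hd := hP (MvPolynomial.mem_support_iff.1 hm)
  -- The component of the weight of a monomial at `x` is the sum of its exponents at the indices
  -- over `x`.
  have hc : ∏ i ∈ m.support, c i.1 ^ m i = ∏ x, c x ^ d x := by
    rw [← hd]
    simp only [Finsupp.weight_apply, Finsupp.sum, Finset.sum_apply, Pi.smul_apply, smul_eq_mul,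
      ← Finset.prod_pow_eq_pow_sum]
    rw [Finset.prod_comm]
    refine Finset.prod_congr rfl fun i _ => ?_
    rw [Finset.prod_eq_single i.1]
    · simp
    · intro x _ hx
      simp [Pi.single_eq_of_ne hx]
    · simp
  simp only [mul_pow, Finset.prod_mul_distrib, hc]
  ring

/-- Changing the frame by matrices `G x` multiplies the coordinates at `x` by `det (G x)`, hence
multiplies the value of `P` by a single factor. Non-vanishing at any frame therefore forces
non-vanishing at the chosen one. -/
theorem mem_basicOpen_iff {P : MvPolynomial (PluckerIndex Q α β) K} {d : Q → ℕ}
    (hP : HasMultidegree P d) {W : Gr K Q α β} :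
    W ∈ basicOpen P ↔ MvPolynomial.eval W.coord P ≠ 0 := by
  constructor
  · rintro ⟨F, hF, h⟩ h0
    choose G hG using fun x =>
      exists_eq_mul_of_span_le ((hF x).trans (W.isFrame_frame x).symm).le
    have : plucker F = fun i => (G i.1).det * W.coord i := by
      funext i
      rw [plucker, hG, coord, plucker, ← Matrix.det_mul, Matrix.submatrix_mul _ _ _ id _
        Function.bijective_id, Matrix.submatrix_id_id]
    rw [this, hP.eval_mul (fun x => (G x).det), h0, mul_zero] at h
    exact h rfl
  · exact fun h => ⟨_, W.isFrame_frame, h⟩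

open scoped Classical in
theorem HasMultidegree.X (x : Q) (I : Fin (β x) → Fin (α x)) :
    HasMultidegree (MvPolynomial.X (R := K) (⟨x, I⟩ : PluckerIndex Q α β)) (Pi.single x 1) :=
  MvPolynomial.isWeightedHomogeneous_X _ _ _

end Gr

/-! ### Piecewise rational functions on the quiver Grassmannian. -/

namespace QuiverGr

variable {K : Type u} [Field K] {Q : FinQuiver} {α β : Q → ℕ} {φ : RepSpace K Q α}

/-- The value of a polynomial at the Plücker coordinates with respect to the chosen frame. -/
noncomputable abbrev eval (W : QuiverGr φ β) (P : MvPolynomial (Gr.PluckerIndex Q α β) K) : K :=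
  MvPolynomial.eval W.1.coord P

theorem isConstructibleSubset_eval_eq_zero {P : MvPolynomial (Gr.PluckerIndex Q α β) K}
    {d : Q → ℕ} (hP : Gr.HasMultidegree P d) :
    IsConstructibleSubset {W : QuiverGr φ β | W.eval P = 0} := by
  have h : IsOpen (Subtype.val ⁻¹' Gr.basicOpen P : Set (QuiverGr φ β)) :=
    IsOpen.preimage continuous_subtype_val
      (TopologicalSpace.GenerateOpen.basic _ ⟨P, ⟨d, hP⟩, rfl⟩)
  convert (IsConstructibleSubset.of_isOpen h).compl using 1
  ext W
  simp [Gr.mem_basicOpen_iff hP]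

/-- On `S` the function `g` is a quotient of multihomogeneous polynomials of the same
multidegree in the Plücker coordinates. -/
def IsRationalOn (S : Set (QuiverGr φ β)) (g : QuiverGr φ β → K) : Prop :=
  ∃ (d : Q → ℕ) (P R : MvPolynomial (Gr.PluckerIndex Q α β) K), Gr.HasMultidegree P d ∧
    Gr.HasMultidegree R d ∧ ∀ W ∈ S, W.eval R ≠ 0 ∧ g W * W.eval R = W.eval P

theorem IsRationalOn.of_const {S : Set (QuiverGr φ β)} {g : QuiverGr φ β → K} (c : K)
    (h : ∀ W ∈ S, g W = c) : IsRationalOn S g :=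
  ⟨0, MvPolynomial.C c, 1, MvPolynomial.isWeightedHomogeneous_C _ _,
    MvPolynomial.isWeightedHomogeneous_one _ _, fun W hW => by simp [h W hW]⟩

theorem IsRationalOn.mul {S T : Set (QuiverGr φ β)} {g h : QuiverGr φ β → K}
    (hg : IsRationalOn S g) (hh : IsRationalOn T h) : IsRationalOn (S ∩ T) (g * h) := by
  obtain ⟨d, P, R, hP, hR, H⟩ := hg
  obtain ⟨d', P', R', hP', hR', H'⟩ := hh
  refine ⟨d + d', P * P', R * R', hP.mul hP', hR.mul hR', fun W hW => ?_⟩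
  obtain ⟨h1, h2⟩ := H W hW.1
  obtain ⟨h1', h2'⟩ := H' W hW.2
  simp only [eval, map_mul, Pi.mul_apply] at *
  exact ⟨mul_ne_zero h1 h1', by rw [← h2, ← h2']; ring⟩

theorem IsRationalOn.add {S T : Set (QuiverGr φ β)} {g h : QuiverGr φ β → K}
    (hg : IsRationalOn S g) (hh : IsRationalOn T h) : IsRationalOn (S ∩ T) (g + h) := by
  obtain ⟨d, P, R, hP, hR, H⟩ := hg
  obtain ⟨d', P', R', hP', hR', H'⟩ := hh
  refine ⟨d + d', P * R' + R * P', R * R', (hP.mul hR').add (hR.mul hP'), hR.mul hR',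
    fun W hW => ?_⟩
  obtain ⟨h1, h2⟩ := H W hW.1
  obtain ⟨h1', h2'⟩ := H' W hW.2
  simp only [eval, map_mul, map_add, Pi.add_apply] at *
  exact ⟨mul_ne_zero h1 h1', by rw [← h2, ← h2']; ring⟩

/-- The function `g` is rational in the Plücker coordinates on the members of a finite
constructible cover. -/
def IsPiecewiseRational (g : QuiverGr φ β → K) : Prop :=
  ∃ 𝒮 : Set (Set (QuiverGr φ β)), 𝒮.Finite ∧ (∀ S ∈ 𝒮, IsConstructibleSubset S) ∧
    (∀ W, ∃ S ∈ 𝒮, W ∈ S) ∧ ∀ S ∈ 𝒮, IsRationalOn S g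

namespace IsPiecewiseRational

variable {g h : QuiverGr φ β → K}

theorem of_isRationalOn_compl {S : Set (QuiverGr φ β)} (hS : IsConstructibleSubset S)
    (h1 : IsRationalOn S g) (h2 : IsRationalOn Sᶜ g) : IsPiecewiseRational g := by
  refine ⟨{S, Sᶜ}, by simp, ?_, fun W => ?_, ?_⟩
  · rintro _ (rfl | rfl)
    exacts [hS, hS.compl]
  · by_cases hW : W ∈ S
    exacts [⟨S, by simp, hW⟩, ⟨Sᶜ, by simp, hW⟩]
  · rintro _ (rfl | rfl)
    exacts [h1, h2]

theorem of_const (c : K) (h : ∀ W, g W = c) : IsPiecewiseRational g :=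
  .of_isRationalOn_compl .univ (.of_const c fun W _ => h W) (.of_const c fun W _ => h W)

theorem combine {k : QuiverGr φ β → K} (hg : IsPiecewiseRational g) (hh : IsPiecewiseRational h)
    (H : ∀ S T, IsRationalOn S g → IsRationalOn T h → IsRationalOn (S ∩ T) k) :
    IsPiecewiseRational k := by
  obtain ⟨𝒮, hfin, hcon, hcov, hrat⟩ := hg
  obtain ⟨𝒯, hfin', hcon', hcov', hrat'⟩ := hh
  refine ⟨Set.image2 (· ∩ ·) 𝒮 𝒯, hfin.image2 _ hfin', ?_, fun W => ?_, ?_⟩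
  · rintro _ ⟨S, hS, T, hT, rfl⟩
    exact (hcon S hS).inter (hcon' T hT)
  · obtain ⟨S, hS, hWS⟩ := hcov W
    obtain ⟨T, hT, hWT⟩ := hcov' W
    exact ⟨S ∩ T, ⟨S, hS, T, hT, rfl⟩, hWS, hWT⟩
  · rintro _ ⟨S, hS, T, hT, rfl⟩
    exact H S T (hrat S hS) (hrat' T hT)

theorem isConstructibleSubset_eq_zero (hg : IsPiecewiseRational g) :
    IsConstructibleSubset {W | g W = 0} := by
  obtain ⟨𝒮, hfin, hcon, hcov, hrat⟩ := hg
  have : {W | g W = 0} = ⋃ S ∈ 𝒮, S ∩ {W | g W = 0} := by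
    ext W
    simp only [Set.mem_iUnion, Set.mem_inter_iff, exists_prop]
    constructor
    · intro h
      obtain ⟨S, hS, hW⟩ := hcov W
      exact ⟨S, hS, hW, h⟩
    · rintro ⟨_, _, _, h⟩
      exact h
  rw [this]
  refine .biUnion hfin fun S hS => ?_
  obtain ⟨d, P, R, hP, -, H⟩ := hrat S hS
  convert (hcon S hS).inter (isConstructibleSubset_eval_eq_zero (φ := φ) hP) using 1
  ext W
  refine and_congr_right fun hW => ?_
  obtain ⟨h1, h2⟩ := H W hW
  simp [← h2, h1]

end IsPiecewiseRational

variable (φ β) in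
/-- The algebra of piecewise rational functions. -/
def piecewiseRational : Subalgebra K (QuiverGr φ β → K) where
  carrier := {g | IsPiecewiseRational g}
  mul_mem' hg hh := hg.combine hh fun _ _ => .mul
  add_mem' hg hh := hg.combine hh fun _ _ => .add
  algebraMap_mem' c := .of_const c fun _ => rfl

theorem isConstructibleAlgebra_piecewiseRational :
    IsConstructibleAlgebra (piecewiseRational β φ) where
  zeros _ hg := IsPiecewiseRational.isConstructibleSubset_eq_zero hg
  indicator _ hg := .of_isRationalOn_compl (IsPiecewiseRational.isConstructibleSubset_eq_zero hg)
    (.of_const 1 fun _ hW => if_pos hW) (.of_const 0 fun _ hW => if_neg hW)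

/-- Since division by zero gives zero, the ratio is constant on the constructible locus where its
denominator vanishes and rational on the complement. -/
theorem coord_div_mem (x : Q) (I J : Fin (β x) → Fin (α x)) :
    (fun W : QuiverGr φ β => W.1.coord ⟨x, J⟩ / W.1.coord ⟨x, I⟩) ∈ piecewiseRational β φ := by
  have h := isConstructibleSubset_eval_eq_zero (φ := φ) (Gr.HasMultidegree.X (K := K) x I)
  simp only [eval, MvPolynomial.eval_X] at h
  refine .of_isRationalOn_compl h (.of_const 0 fun W hW => ?_)
    ⟨_, _, _, Gr.HasMultidegree.X x J, Gr.HasMultidegree.X x I, fun W hW => ?_⟩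
  · rw [show W.1.coord ⟨x, I⟩ = 0 from hW, div_zero]
  · have hW : W.1.coord ⟨x, I⟩ ≠ 0 := hW
    simp only [eval, MvPolynomial.eval_X]
    exact ⟨hW, div_mul_cancel₀ _ hW⟩

/-! ### The tautological subspaces and the families of sub- and quotient representations. -/

/-- This is Cramer's rule. It needs no nonvanishing minor: for a singular submatrix both the
quotient and the inverse matrix are zero by convention. -/
theorem coord_div_eq (W : Gr K Q α β) (x : Q) (I : Fin (β x) → Fin (α x)) (i : Fin (β x))
    (j : Fin (α x)) :
    W.coord ⟨x, Function.update I i j⟩ / W.coord ⟨x, I⟩ =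
      (((W.frame x).submatrix id I)⁻¹ * W.frame x) i j := by
  set F := W.frame x with hF
  have h : F.submatrix id (Function.update I i j) =
      (F.submatrix id I).updateCol i (fun k => F k j) := by
    ext k l
    by_cases hl : l = i
    · subst hl
      simp
    · simp [hl]
  rw [Gr.coord, Gr.plucker, Gr.plucker, ← hF, h, ← Matrix.cramer_apply,
    Matrix.cramer_eq_adjugate_mulVec, Matrix.inv_def, Ring.inverse_eq_inv', Matrix.smul_mul,
    Matrix.smul_apply, smul_eq_mul, div_eq_inv_mul, Matrix.mul_apply]
  rfl

/-- All charts are used at once: for every list of columns `I`, the rows of the frame normalised at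
`I` lie in `W`. They span `W` if the minor at `I` is nonzero, and are zero otherwise. -/
theorem isGenerated_subspace (x : Q) :
    IsGenerated (coordSections (piecewiseRational β φ) (Fin (α x)))
      (fun W : QuiverGr φ β => W.1.1 x) := by
  refine .of_finite (ι := (Fin (β x) → Fin (α x)) × Fin (β x))
    (fun e W j => W.1.coord ⟨x, Function.update e.1 e.2 j⟩ / W.1.coord ⟨x, e.1⟩)
    (fun e j => coord_div_mem x _ _) fun W => ?_
  simp_rw [coord_div_eq]
  rw [← W.1.isFrame_frame x]
  apply le_antisymm
  -- One chart with nonzero minor suffices for spanning, as the frame is recovered by multiplying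
  -- its normalisation by the invertible submatrix.
  · obtain ⟨I, hI⟩ := exists_submatrix_det_ne_zero (W.1.isFrame_frame.linearIndependent x)
    have h := span_range_mul_le ((W.1.frame x).submatrix id I)
      (((W.1.frame x).submatrix id I)⁻¹ * W.1.frame x)
    rw [Matrix.mul_nonsing_inv_cancel_left _ _ (isUnit_iff_ne_zero.2 hI)] at h
    refine h.trans (Submodule.span_mono ?_)
    rintro _ ⟨i, rfl⟩
    exact ⟨(I, i), rfl⟩
  · rw [Submodule.span_le]
    rintro _ ⟨⟨I, i⟩, rfl⟩
    exact span_range_mul_le _ _ (Submodule.subset_span ⟨i, rfl⟩)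

/-- The matrix of `f` is constant and C contains the constants. As `φ` is fixed, this makes the
arrows preserve sections. -/
theorem map_mem_coordSections {X : Type u} {C : Subalgebra K (X → K)} {ι κ : Type} [Fintype ι]
    (f : (ι → K) →ₗ[K] (κ → K)) {s : X → ι → K} (hs : s ∈ coordSections C ι) :
    (fun p => f (s p)) ∈ coordSections C κ := by
  classical
  have := sum_smul_mem (coordSections C κ) (t := fun i _ => f (Pi.single i 1))
    (fun i j => C.algebraMap_mem (f (Pi.single i 1) j)) hs
  convert this using 2 with p
  rw [LinearMap.pi_apply_eq_sum_univ f (s p), Fintype.linearCombination_apply]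
  refine Finset.sum_congr rfl fun i _ => ?_
  congr 2
  funext j
  simp [Pi.single_apply, eq_comm]

theorem isCoherentFamily_subrep :
    IsCoherentFamily (piecewiseRational β φ) (fun W : QuiverGr φ β => W.subrep) := by
  refine ⟨fun x => subSections (coordSections _ (Fin (α x))) (fun W : QuiverGr φ β => W.1.1 x),
    fun x => (isCoherent_coordSections isConstructibleAlgebra_piecewiseRational _).sub
      (isGenerated_subspace x), fun x y a s hs => ?_⟩
  have hs' : (fun W => (W.1.1 x).subtype (s W)) ∈
      coordSections (piecewiseRational β φ) (Fin (α x)) := hs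
  exact map_mem_coordSections (φ a) hs'

theorem isCoherentFamily_quotrep :
    IsCoherentFamily (piecewiseRational β φ) (fun W : QuiverGr φ β => W.quotrep) := by
  refine ⟨fun x => quotSections (coordSections _ (Fin (α x))) (fun W : QuiverGr φ β => W.1.1 x),
    fun x => (isCoherent_coordSections isConstructibleAlgebra_piecewiseRational _).quot
      (isGenerated_subspace x), ?_⟩
  rintro x y a s ⟨t, ht, h⟩
  refine ⟨_, map_mem_coordSections (φ a) ht, fun W => ?_⟩
  beta_reduce
  rw [h]
  rfl

end QuiverGr

end RankLoci

theorem corollary4p2 {K : Type u} [Field K] (Q : RankLoci.FinQuiver) (α β : Q → ℕ)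
    (φ : RankLoci.RepSpace K Q α) (S : Set (RankLoci.QuiverGr φ β))
    (hS : RankLoci.QuiverGr.IsRankLocus S) :
    RankLoci.IsConstructibleSubset S := by
  obtain ⟨m, n, r, a, b, c, strict, hr, h⟩ := hS
  -- All ranks of subrepresentation and quotient are collected into one constructible map; the rank
  -- locus is the preimage of the set of value vectors satisfying the inequalities.
  have key : RankLoci.IsConstructibleMap (fun (W : RankLoci.QuiverGr φ β) (i : Fin m ⊕ Fin m) =>
      (Sum.elim (fun i W => r i W.subrep) (fun i W => r i W.quotrep) :
        Fin m ⊕ Fin m → RankLoci.QuiverGr φ β → ℕ) i W) := by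
    refine .pi ?_
    rintro (i | i)
    · exact (hr i).isConstructibleMap
        RankLoci.QuiverGr.isConstructibleAlgebra_piecewiseRational
        RankLoci.QuiverGr.isCoherentFamily_subrep
    · exact (hr i).isConstructibleMap
        RankLoci.QuiverGr.isConstructibleAlgebra_piecewiseRational
        RankLoci.QuiverGr.isCoherentFamily_quotrep
  convert key.preimage {t | ∀ l,
    ∑ i, (a l i * t (Sum.inl i) + b l i * t (Sum.inr i)) ≤ c l ∧
    (l ∈ strict → ∑ i, (a l i * t (Sum.inl i) + b l i * t (Sum.inr i)) < c l)} using 1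
  ext W
  exact h W
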